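/- Let $\sigma$ be a permutation of $\mathbb{Z}$, let $C^*(F_{\mathbb{Z}})$ be the full group $C^*$-algebra of the free group $F_{\mathbb{Z}}$ on generators indexed by $\mathbb{Z}$, with canonical unitaries $\{u_j\}_{j\in\mathbb{Z}}$ (the images of the generators), and let $\sigma_*$ be the $*$-automorphism of $C^*(F_{\mathbb{Z}})$ with $\sigma_*(u_j)=u_{\sigma(j)}$ for all $j\in\mathbb{Z}$. Let $S$ be the state space of $C^*(F_{\mathbb{Z}})$, i.e. the set of positive unital linear functionals with the weak$^*$ topology, and let $T_{\sigma_*}:S\to S$ be the homeomorphism $T_{\sigma_*}(\varphi)=\varphi\circ\sigma_*$. Then $$h_{\mathrm{top}}(T_{\sigma_*})=\infty \iff \sigma \text{ has an infinite orbit},$$ where the topological entropy is $h_{\mathrm{top}}(T)=\sup_{\mathcal U}\lim_{n\to\infty}\frac1n\log N(\mathcal U\vee T^{-1}\mathcal U\vee\cdots\vee T^{-(n-1)}\mathcal U)$, the supremum being over all finite open covers $\mathcal U$ of $S$ and $N(\cdot)$ denoting the smallest cardinality of a subcover. -/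

import Mathlib

/-! ### Topological entropy through finite open covers -/

section Entropy

open Set Filter

variable {X : Type*}

/-- The join `𝒰 ∨ T⁻¹𝒰 ∨ ⋯ ∨ T^{-(n-1)}𝒰`: all sets `⋂_{k < n} T^{-k} (s k)` with `s k ∈ 𝒰`. -/
def iteratedJoin (T : X → X) (𝒰 : Set (Set X)) (n : ℕ) : Set (Set X) :=
  {V | ∃ s : Fin n → Set X, (∀ k, s k ∈ 𝒰) ∧ V = ⋂ k : Fin n, T^[k] ⁻¹' s k}

/-- The smallest cardinality of a (finite) subcover of `𝒱`. -/
noncomputable def minSubcoverCard (𝒱 : Set (Set X)) : ℕ :=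
  sInf {m | ∃ 𝒲 ⊆ 𝒱, 𝒲.Finite ∧ ⋃₀ 𝒲 = univ ∧ 𝒲.ncard = m}

/-- The entropy `lim_n (1/n) log N(𝒰 ∨ T⁻¹𝒰 ∨ ⋯ ∨ T^{-(n-1)}𝒰)` of `T` relative to the cover `𝒰`.
The sequence `log N(⋯)` is subadditive, so that the limit exists and equals the limit superior. -/
noncomputable def coverEntropyOf (T : X → X) (𝒰 : Set (Set X)) : EReal :=
  limsup (fun n : ℕ => ((Real.log (minSubcoverCard (iteratedJoin T 𝒰 n)) / n : ℝ) : EReal)) atTop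

/-- The topological entropy of `T`: the supremum of the entropies of `T` relative to the finite
open covers of `X`. -/
noncomputable def topEntropy [TopologicalSpace X] (T : X → X) : EReal :=
  ⨆ (𝒰 : Set (Set X)) (_ : 𝒰.Finite ∧ (∀ U ∈ 𝒰, IsOpen U) ∧ ⋃₀ 𝒰 = univ), coverEntropyOf T 𝒰

end Entropy

/-! ### The state space of a unital C⋆-algebra -/

section States

open scoped ComplexOrder

variable (A : Type*) [CStarAlgebra A]

/-- The state space of `A`, i.e. the positive unital linear functionals; as a subtype of
`WeakDual ℂ A` it carries the weak⋆ topology. -/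
def StateSpace : Type _ :=
  {φ : WeakDual ℂ A // (∀ a : A, 0 ≤ φ (star a * a)) ∧ φ 1 = 1}

instance : TopologicalSpace (StateSpace A) :=
  inferInstanceAs (TopologicalSpace {φ : WeakDual ℂ A // (∀ a : A, 0 ≤ φ (star a * a)) ∧ φ 1 = 1})

variable {A}

/-- An automorphism of a C⋆-algebra as a continuous linear map (it is isometric). -/
noncomputable def autCLM (α : A ≃⋆ₐ[ℂ] A) : A →L[ℂ] A where
  toFun := α
  map_add' := map_add α
  map_smul' := map_smul α
  cont := (NonUnitalStarAlgHom.isometry α α.injective).continuous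

/-- The map `φ ↦ φ ∘ α` on the state space. -/
noncomputable def stateSpaceMap (α : A ≃⋆ₐ[ℂ] A) (φ : StateSpace A) : StateSpace A :=
  ⟨StrongDual.toWeakDual ((WeakDual.toStrongDual φ.1).comp (autCLM α)), by
    refine ⟨fun a => ?_, ?_⟩
    · have h := φ.2.1 (α a)
      rw [← map_star, ← map_mul] at h
      exact h
    · change φ.1 (α 1) = 1
      rw [map_one]
      exact φ.2.2⟩

theorem stateSpaceMap_apply (α : A ≃⋆ₐ[ℂ] A) (φ : StateSpace A) (a : A) :
    (stateSpaceMap α φ).1 a = φ.1 (α a) := rfl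

theorem continuous_stateSpaceMap (α : A ≃⋆ₐ[ℂ] A) : Continuous (stateSpaceMap α) := by
  refine Continuous.subtype_mk (WeakDual.continuous_of_continuous_eval fun a => ?_) _
  exact (WeakDual.eval_continuous (α a)).comp continuous_subtype_val

/-- The homeomorphism `T_α : φ ↦ φ ∘ α` of the state space induced by an automorphism `α`. -/
noncomputable def stateSpaceHomeomorph (α : A ≃⋆ₐ[ℂ] A) : StateSpace A ≃ₜ StateSpace A where
  toFun := stateSpaceMap α
  invFun := stateSpaceMap α.symm
  left_inv φ := Subtype.ext <| DFunLike.ext _ _ fun a => by simp [stateSpaceMap_apply]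
  right_inv φ := Subtype.ext <| DFunLike.ext _ _ fun a => by simp [stateSpaceMap_apply]
  continuous_toFun := continuous_stateSpaceMap α
  continuous_invFun := continuous_stateSpaceMap α.symm

end States

/-! ### The full C⋆-algebra of a discrete group

It is the completion of the complex group algebra `ℂ[G]`, with the involution `g ↦ g⁻¹`, in the
seminorm `‖a‖ = sup_π ‖π(a)‖`, where `π` runs over all unitary representations of `G`. -/

universe u

/-- A unitary representation of `G` on a complex Hilbert space.  (Every cyclic representation of
`G : Type u` is unitarily equivalent to one on a space in `Type u`, so that the universe is no
restriction for the seminorm below.) -/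
structure UnitaryRep (G : Type u) [Group G] : Type (u + 1) where
  H : Type u
  [normedAddCommGroup : NormedAddCommGroup H]
  [innerProductSpace : InnerProductSpace ℂ H]
  [completeSpace : CompleteSpace H]
  hom : G →* unitary (H →L[ℂ] H)

attribute [instance] UnitaryRep.normedAddCommGroup UnitaryRep.innerProductSpace
  UnitaryRep.completeSpace

/-- The group algebra `ℂ[G]`, as a type that is to carry the maximal C⋆-seminorm. -/
def GroupAlg (G : Type u) : Type u := MonoidAlgebra ℂ G

namespace GroupAlg

variable {G K : Type u} [Group G] [Group K]

noncomputable instance : Ring (GroupAlg G) := inferInstanceAs (Ring (MonoidAlgebra ℂ G))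

noncomputable instance : Algebra ℂ (GroupAlg G) :=
  inferInstanceAs (Algebra ℂ (MonoidAlgebra ℂ G))

/-- The element `c • g` of `ℂ[G]`. -/
noncomputable def single (g : G) (c : ℂ) : GroupAlg G := MonoidAlgebra.single g c

@[elab_as_elim]
theorem induction {p : GroupAlg G → Prop} (x : GroupAlg G) (zero : p 0)
    (add : ∀ x y, p x → p y → p (x + y)) (sing : ∀ g c, p (single g c)) : p x :=
  MonoidAlgebra.induction_linear (motive := p) x zero add sing

theorem single_mul_single (g h : G) (c d : ℂ) :
    single g c * single h d = single (g * h) (c * d) := MonoidAlgebra.single_mul_single ..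

theorem smul_single (c d : ℂ) (g : G) : c • single g d = single g (c * d) :=
  MonoidAlgebra.smul_single ..

/-- The involution of `ℂ[G]`, the additive map with `c • g ↦ conj c • g⁻¹`. -/
noncomputable def starHom : GroupAlg G →+ GroupAlg G where
  toFun a := MonoidAlgebra.mapDomain (fun g : G => g⁻¹)
    (MonoidAlgebra.map (starRingEnd ℂ : ℂ →+ ℂ) a)
  map_zero' := (congrArg _ (MonoidAlgebra.map_zero _)).trans (MonoidAlgebra.mapDomain_zero _)
  map_add' a b := (congrArg _ (MonoidAlgebra.map_add _ a b)).trans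
    (MonoidAlgebra.mapDomain_add _ _ _)

theorem starHom_single (g : G) (c : ℂ) :
    starHom (single g c) = single g⁻¹ (starRingEnd ℂ c) := by
  change MonoidAlgebra.mapDomain _ (MonoidAlgebra.map _ (MonoidAlgebra.single g c)) = _
  rw [MonoidAlgebra.map_single, MonoidAlgebra.mapDomain_single]
  rfl

noncomputable instance : StarRing (GroupAlg G) where
  star := starHom
  star_add := map_add starHom
  star_involutive a := by
    induction a using GroupAlg.induction with
    | zero => simp
    | add x y hx hy => simp [hx, hy]
    | sing g c => simp [starHom_single]
  star_mul a b := by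
    change starHom (a * b) = starHom b * starHom a
    induction a using GroupAlg.induction with
    | zero => simp
    | add x y hx hy => simp [add_mul, mul_add, hx, hy]
    | sing g c =>
      induction b using GroupAlg.induction with
      | zero => simp
      | add x y hx hy => simp [add_mul, mul_add, hx, hy]
      | sing h d => simp [starHom_single, single_mul_single, mul_comm]

theorem star_single (g : G) (c : ℂ) : star (single g c) = single g⁻¹ (star c) :=
  starHom_single g c

instance : StarModule ℂ (GroupAlg G) where
  star_smul c a := by
    induction a using GroupAlg.induction with
    | zero => simp
    | add x y hx hy => simp only [smul_add, star_add, hx, hy]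
    | sing g d => simp [star_single, smul_single]

/-- The extension of a unitary representation to `ℂ[G]`, `∑ c_g g ↦ ∑ c_g π(g)`. -/
noncomputable def rep (π : UnitaryRep G) : GroupAlg G →ₐ[ℂ] (π.H →L[ℂ] π.H) :=
  MonoidAlgebra.lift ℂ (π.H →L[ℂ] π.H) G ((unitary (π.H →L[ℂ] π.H)).subtype.comp π.hom)

theorem rep_single (π : UnitaryRep G) (g : G) (c : ℂ) :
    rep π (single g c) = c • (π.hom g : π.H →L[ℂ] π.H) := MonoidAlgebra.lift_single ..

theorem rep_star (π : UnitaryRep G) (a : GroupAlg G) : rep π (star a) = star (rep π a) := by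
  induction a using GroupAlg.induction with
  | zero => simp
  | add x y hx hy => simp only [star_add, map_add, hx, hy]
  | sing g c => simp [star_single, rep_single, ← Unitary.star_eq_inv]

theorem exists_norm_rep_le (a : GroupAlg G) : ∃ C, ∀ π : UnitaryRep G, ‖rep π a‖ ≤ C := by
  induction a using GroupAlg.induction with
  | zero => exact ⟨0, fun π => by simp⟩
  | add x y hx hy =>
    obtain ⟨C, hC⟩ := hx
    obtain ⟨D, hD⟩ := hy
    refine ⟨C + D, fun π => ?_⟩
    rw [map_add]
    exact (norm_add_le _ _).trans (add_le_add (hC π) (hD π))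
  | sing g c =>
    refine ⟨‖c‖ * 1, fun π => ?_⟩
    rw [rep_single, norm_smul]
    refine mul_le_mul_of_nonneg_left ?_ (norm_nonneg c)
    have h : ‖(π.hom g : π.H →L[ℂ] π.H)‖ * ‖(π.hom g : π.H →L[ℂ] π.H)‖ ≤ 1 := by
      rw [← CStarRing.norm_star_mul_self, Unitary.coe_star_mul_self]
      exact ContinuousLinearMap.norm_id_le
    nlinarith [norm_nonneg (π.hom g : π.H →L[ℂ] π.H)]

/-- The maximal C⋆-seminorm `‖a‖ = sup_π ‖π(a)‖` on `ℂ[G]`. -/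
noncomputable instance : Norm (GroupAlg G) := ⟨fun a => ⨆ π : UnitaryRep G, ‖rep π a‖⟩

theorem norm_def (a : GroupAlg G) : ‖a‖ = ⨆ π : UnitaryRep G, ‖rep π a‖ := rfl

theorem bddAbove (a : GroupAlg G) :
    BddAbove (Set.range fun π : UnitaryRep G => ‖rep π a‖) := by
  obtain ⟨C, hC⟩ := exists_norm_rep_le a
  exact ⟨C, by rintro _ ⟨π, rfl⟩; exact hC π⟩

theorem norm_rep_le (π : UnitaryRep G) (a : GroupAlg G) : ‖rep π a‖ ≤ ‖a‖ :=
  le_ciSup (bddAbove a) π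

theorem norm_nonneg' (a : GroupAlg G) : 0 ≤ ‖a‖ := Real.iSup_nonneg fun _ => norm_nonneg _

theorem norm_le {a : GroupAlg G} {C : ℝ} (hC : 0 ≤ C) (h : ∀ π : UnitaryRep G, ‖rep π a‖ ≤ C) :
    ‖a‖ ≤ C := Real.iSup_le h hC

noncomputable instance : SeminormedRing (GroupAlg G) :=
  { (inferInstance : Ring (GroupAlg G)), (inferInstance : Norm (GroupAlg G)),
    SeminormedAddCommGroup.ofCore (𝕜 := ℂ)
      { norm_nonneg := norm_nonneg'
        norm_smul := fun c a => by
          simp only [norm_def, map_smul, norm_smul]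
          exact (Real.mul_iSup_of_nonneg (norm_nonneg c) _).symm
        norm_triangle := fun a b => norm_le (add_nonneg (norm_nonneg' a) (norm_nonneg' b))
          fun π => by
            rw [map_add]
            exact (norm_add_le _ _).trans (add_le_add (norm_rep_le π a) (norm_rep_le π b)) } with
    norm_mul_le := fun a b => norm_le (mul_nonneg (norm_nonneg' a) (norm_nonneg' b)) fun π => by
      rw [map_mul]
      exact (norm_mul_le _ _).trans (mul_le_mul (norm_rep_le π a) (norm_rep_le π b)
        (norm_nonneg _) (norm_nonneg' a)) }

noncomputable instance : NormedAlgebra ℂ (GroupAlg G) where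
  norm_smul_le c a := norm_le (mul_nonneg (norm_nonneg c) (norm_nonneg' a)) fun π => by
    rw [map_smul, norm_smul]
    exact mul_le_mul_of_nonneg_left (norm_rep_le π a) (norm_nonneg c)

theorem norm_star' (a : GroupAlg G) : ‖star a‖ = ‖a‖ := by
  simp only [norm_def, rep_star, norm_star]

theorem norm_mul_self_le' (a : GroupAlg G) : ‖a‖ * ‖a‖ ≤ ‖star a * a‖ := by
  have h : ‖a‖ ≤ Real.sqrt ‖star a * a‖ := norm_le (Real.sqrt_nonneg _) fun π => by
    refine Real.le_sqrt_of_sq_le ?_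
    have := norm_rep_le π (star a * a)
    rwa [map_mul, rep_star, CStarRing.norm_star_mul_self, ← sq] at this
  calc ‖a‖ * ‖a‖ ≤ Real.sqrt ‖star a * a‖ * Real.sqrt ‖star a * a‖ :=
        mul_le_mul h h (norm_nonneg' a) (Real.sqrt_nonneg _)
    _ = _ := Real.mul_self_sqrt (norm_nonneg' _)

/-- The homomorphism `ℂ[G] → ℂ[K]` induced by a group homomorphism `G → K`. -/
noncomputable def map (f : G →* K) : GroupAlg G →ₐ[ℂ] GroupAlg K :=
  MonoidAlgebra.mapDomainAlgHom ℂ ℂ f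

theorem map_single (f : G →* K) (g : G) (c : ℂ) : map f (single g c) = single (f g) c :=
  MonoidAlgebra.mapDomain_single

theorem map_star (f : G →* K) (a : GroupAlg G) : map f (star a) = star (map f a) := by
  induction a using GroupAlg.induction with
  | zero => simp
  | add x y hx hy => simp only [star_add, map_add, hx, hy]
  | sing g c => simp [star_single, map_single]

theorem rep_map (f : G →* K) (π : UnitaryRep K) (a : GroupAlg G) :
    rep π (map f a) = rep ⟨π.H, π.hom.comp f⟩ a := by
  induction a using GroupAlg.induction with
  | zero => simp
  | add x y hx hy => simp only [map_add, hx, hy]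
  | sing g c => rw [map_single, rep_single, rep_single]; rfl

theorem norm_map_le (f : G →* K) (a : GroupAlg G) : ‖map f a‖ ≤ ‖a‖ :=
  norm_le (norm_nonneg' a) fun π => by
    rw [rep_map]
    exact norm_rep_le (⟨π.H, π.hom.comp f⟩ : UnitaryRep G) a

theorem continuous_map (f : G →* K) : Continuous (map f) :=
  AddMonoidHomClass.continuous_of_bound (map f) 1 fun a => by
    rw [one_mul]
    exact norm_map_le f a

end GroupAlg

/-- The full group C⋆-algebra `C⋆(G)` of a discrete group `G`. -/
def FullGroupCStar (G : Type u) [Group G] : Type u := UniformSpace.Completion (GroupAlg G)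

namespace FullGroupCStar

open UniformSpace

variable {G K : Type u} [Group G] [Group K]

noncomputable instance : NormedRing (FullGroupCStar G) :=
  inferInstanceAs (NormedRing (Completion (GroupAlg G)))

instance : CompleteSpace (FullGroupCStar G) :=
  inferInstanceAs (CompleteSpace (Completion (GroupAlg G)))

/-- The canonical map `ℂ[G] → C⋆(G)`, which has dense range. -/
noncomputable def ofAlg (a : GroupAlg G) : FullGroupCStar G := (a : Completion (GroupAlg G))

theorem continuous_ofAlg : Continuous (ofAlg (G := G)) := Completion.continuous_coe _

@[elab_as_elim]
theorem induction {p : FullGroupCStar G → Prop} (x : FullGroupCStar G)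
    (hp : IsClosed {x | p x}) (ih : ∀ a, p (ofAlg a)) : p x :=
  Completion.induction_on x hp ih

theorem ofAlg_add (a b : GroupAlg G) : ofAlg (a + b) = ofAlg a + ofAlg b :=
  Completion.coe_add a b

theorem ofAlg_mul (a b : GroupAlg G) : ofAlg (a * b) = ofAlg a * ofAlg b :=
  Completion.coe_mul a b

theorem norm_ofAlg (a : GroupAlg G) : ‖ofAlg a‖ = ‖a‖ := Completion.norm_coe a

noncomputable instance : Algebra ℂ (FullGroupCStar G) :=
  inferInstanceAs (Algebra ℂ (Completion (GroupAlg G)))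

theorem ofAlg_smul (c : ℂ) (a : GroupAlg G) : ofAlg (c • a) = c • ofAlg a :=
  Completion.coe_smul c a

noncomputable instance : NormedAlgebra ℂ (FullGroupCStar G) where
  norm_smul_le c x := norm_smul_le (β := Completion (GroupAlg G)) c x

/-- The involution of `C⋆(G)`, the continuous extension of that of `ℂ[G]`. -/
noncomputable instance : Star (FullGroupCStar G) :=
  ⟨Completion.map (star : GroupAlg G → GroupAlg G)⟩

theorem uniformContinuous_star' : UniformContinuous (star : GroupAlg G → GroupAlg G) :=
  uniformContinuous_addMonoidHom_of_continuous (f := GroupAlg.starHom (G := G))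
    (AddMonoidHomClass.continuous_of_bound _ 1 fun a => by
      rw [one_mul]
      exact (GroupAlg.norm_star' a).le)

theorem continuous_star' : Continuous (star : FullGroupCStar G → FullGroupCStar G) :=
  Completion.continuous_map

theorem star_ofAlg (a : GroupAlg G) : star (ofAlg a) = ofAlg (star a) :=
  Completion.map_coe uniformContinuous_star' a

noncomputable instance : StarRing (FullGroupCStar G) where
  star_involutive x := by
    induction x using FullGroupCStar.induction with
    | hp => exact isClosed_eq (continuous_star'.comp continuous_star') continuous_id
    | ih a => rw [star_ofAlg, star_ofAlg, star_star]
  star_add x y := by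
    induction x using FullGroupCStar.induction with
    | hp =>
      exact isClosed_eq (continuous_star'.comp (continuous_id.add continuous_const))
        (continuous_star'.add continuous_const)
    | ih a =>
      induction y using FullGroupCStar.induction with
      | hp =>
        exact isClosed_eq (continuous_star'.comp (continuous_const.add continuous_id))
          (continuous_const.add continuous_star')
      | ih b => rw [← ofAlg_add, star_ofAlg, star_ofAlg, star_ofAlg, star_add, ofAlg_add]
  star_mul x y := by
    induction x using FullGroupCStar.induction with
    | hp =>
      exact isClosed_eq (continuous_star'.comp (continuous_id.mul continuous_const))
        (continuous_const.mul continuous_star')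
    | ih a =>
      induction y using FullGroupCStar.induction with
      | hp =>
        exact isClosed_eq (continuous_star'.comp (continuous_const.mul continuous_id))
          (continuous_star'.mul continuous_const)
      | ih b => rw [← ofAlg_mul, star_ofAlg, star_ofAlg, star_ofAlg, star_mul, ofAlg_mul]

noncomputable instance : CStarAlgebra (FullGroupCStar G) where
  norm_mul_self_le x := by
    induction x using FullGroupCStar.induction with
    | hp =>
      exact isClosed_le (continuous_norm.mul continuous_norm)
        (continuous_norm.comp (continuous_star'.mul continuous_id))
    | ih a =>
      rw [star_ofAlg, ← ofAlg_mul, norm_ofAlg, norm_ofAlg]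
      exact GroupAlg.norm_mul_self_le' a
  star_smul c x := by
    induction x using FullGroupCStar.induction with
    | hp =>
      exact isClosed_eq (continuous_star'.comp (continuous_const_smul c))
        ((continuous_const_smul (star c)).comp continuous_star')
    | ih a => rw [← ofAlg_smul, star_ofAlg, star_ofAlg, star_smul, ofAlg_smul]

/-- The canonical unitary `u_g ∈ C⋆(G)` of a group element `g`. -/
noncomputable def u (g : G) : FullGroupCStar G := ofAlg (GroupAlg.single g 1)

/-- The map `C⋆(G) → C⋆(K)` induced by a group homomorphism `f`, the continuous extension of
`ℂ[G] → ℂ[K]`. -/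
noncomputable def map (f : G →* K) : FullGroupCStar G → FullGroupCStar K :=
  Completion.map (GroupAlg.map f)

theorem continuous_map (f : G →* K) : Continuous (map f) := Completion.continuous_map

theorem map_ofAlg (f : G →* K) (a : GroupAlg G) : map f (ofAlg a) = ofAlg (GroupAlg.map f a) :=
  Completion.map_coe (uniformContinuous_addMonoidHom_of_continuous (GroupAlg.continuous_map f)) a

theorem map_u (f : G →* K) (g : G) : map f (u g) = u (f g) := by
  rw [u, map_ofAlg, GroupAlg.map_single, u]

theorem map_map_symm (e : G ≃* K) (x : FullGroupCStar K) :
    map (e : G →* K) (map (e.symm : K →* G) x) = x := by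
  induction x using FullGroupCStar.induction with
  | hp => exact isClosed_eq ((continuous_map _).comp (continuous_map _)) continuous_id
  | ih a =>
    rw [map_ofAlg, map_ofAlg]
    congr 1
    induction a using GroupAlg.induction with
    | zero => simp
    | add x y hx hy => simp only [map_add, hx, hy]
    | sing g c => simp [GroupAlg.map_single]

/-- The isomorphism `C⋆(G) ≃ C⋆(K)` induced by an isomorphism `G ≃ K`. -/
noncomputable def mapEquiv (e : G ≃* K) : FullGroupCStar G ≃⋆ₐ[ℂ] FullGroupCStar K where
  toFun := map (e : G →* K)
  invFun := map (e.symm : K →* G)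
  left_inv x := map_map_symm e.symm x
  right_inv x := map_map_symm e x
  map_mul' x y := by
    induction x using FullGroupCStar.induction with
    | hp =>
      exact isClosed_eq ((continuous_map _).comp (continuous_id.mul continuous_const))
        ((continuous_map _).mul continuous_const)
    | ih a =>
      induction y using FullGroupCStar.induction with
      | hp =>
        exact isClosed_eq ((continuous_map _).comp (continuous_const.mul continuous_id))
          (continuous_const.mul (continuous_map _))
      | ih b => rw [← ofAlg_mul, map_ofAlg, map_ofAlg, map_ofAlg, map_mul, ofAlg_mul]
  map_add' x y := by
    induction x using FullGroupCStar.induction with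
    | hp =>
      exact isClosed_eq ((continuous_map _).comp (continuous_id.add continuous_const))
        ((continuous_map _).add continuous_const)
    | ih a =>
      induction y using FullGroupCStar.induction with
      | hp =>
        exact isClosed_eq ((continuous_map _).comp (continuous_const.add continuous_id))
          (continuous_const.add (continuous_map _))
      | ih b => rw [← ofAlg_add, map_ofAlg, map_ofAlg, map_ofAlg, map_add, ofAlg_add]
  map_star' x := by
    induction x using FullGroupCStar.induction with
    | hp =>
      exact isClosed_eq ((continuous_map _).comp continuous_star')
        (continuous_star'.comp (continuous_map _))
    | ih a => rw [star_ofAlg, map_ofAlg, map_ofAlg, star_ofAlg, GroupAlg.map_star]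
  map_smul' c x := by
    induction x using FullGroupCStar.induction with
    | hp =>
      exact isClosed_eq ((continuous_map _).comp (continuous_const_smul c))
        ((continuous_const_smul c).comp (continuous_map _))
    | ih a => rw [← ofAlg_smul, map_ofAlg, map_ofAlg, map_smul, ofAlg_smul]

theorem mapEquiv_u (e : G ≃* K) (g : G) : mapEquiv e (u g) = u (e g) := map_u (e : G →* K) g

end FullGroupCStar

/-- The free permutation automorphism `σ_*` of the full free group C⋆-algebra `C⋆(F_ℤ)`, induced
by the automorphism of the free group that permutes the generators by `σ`. -/
noncomputable def freePermAut (σ : Equiv.Perm ℤ) :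
    FullGroupCStar (FreeGroup ℤ) ≃⋆ₐ[ℂ] FullGroupCStar (FreeGroup ℤ) :=
  FullGroupCStar.mapEquiv (FreeGroup.freeGroupCongr σ)

/-- `σ_*` sends the canonical unitary `u_j` to `u_{σ(j)}`. -/
theorem freePermAut_u (σ : Equiv.Perm ℤ) (j : ℤ) :
    freePermAut σ (FullGroupCStar.u (FreeGroup.of j)) = FullGroupCStar.u (FreeGroup.of (σ j)) := by
  rw [freePermAut, FullGroupCStar.mapEquiv_u]
  rfl

/-!
Restriction of states to the canonical unitaries, `φ ↦ (φ (u g))_g`, is injective since the linear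
span of the `u g` is dense, and the state space is weak⋆ compact; hence these coordinates induce its
topology. In them, the homeomorphism `φ ↦ φ ∘ σ_*` permutes the coordinates according to the action
of `σ` on words, `φ (u g) ↦ φ (u (σ g))`.

If all orbits of `σ` are finite, so are its orbits on words, as a word involves finitely many
generators. Each coordinate is then moved within a finite set, which makes the iterates of the
homeomorphism uniformly equicontinuous. On a compact space this bounds the number of elements of the
iterated joins that are needed for a cover (`topEntropy_le_zero_of_uniformEquicontinuous`), and the
entropy is at most zero.

If the orbit of `j` is infinite, the points `σ^k j` are pairwise distinct, and the generators with
these indices can be sent to arbitrary unimodular scalars by one-dimensional representations of the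
free group. The associated states realize every sequence of unimodular numbers as the values of
`φ (u_j)` along an orbit of the homeomorphism. So the cover of the state space by the `m` conditions
"`φ (u_j)` avoids all of `w_1, …, w_m` except possibly `w_i`" has entropy at least `log m`, for every
`m` (`topEntropy_eq_top_of_realizes_sequences`).
-/

/-! ### Entropy of a dynamical system: two criteria -/

section EntropyCriteria

open Set Filter Function Uniformity

variable {X : Type*}

/-- A map whose iterates are uniformly equicontinuous has entropy at most zero: the number of
elements of the `n`-fold join needed to cover the space is bounded independently of `n`. -/
theorem topEntropy_le_zero_of_uniformEquicontinuous [UniformSpace X] [CompactSpace X] {T : X → X}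
    (hT : UniformEquicontinuous fun k : ℕ => T^[k]) : topEntropy T ≤ 0 := by
  refine iSup₂_le fun 𝒰 ⟨_, hopen, hcov⟩ => ?_
  obtain ⟨V, hV, hVU⟩ := lebesgue_number_lemma (ι := 𝒰) (U := Subtype.val) isCompact_univ
    (fun U => hopen U U.2) (by rw [← sUnion_eq_iUnion, hcov])
  choose c hc using fun x : X => hVU x (mem_univ x)
  obtain ⟨t, -, ht⟩ := isCompact_univ.elim_nhds_subcover
    (fun x => UniformSpace.ball x {p | ∀ k, (T^[k] p.1, T^[k] p.2) ∈ V})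
    fun x _ => UniformSpace.ball_mem_nhds x (hT V hV)
  have hcard (n : ℕ) : minSubcoverCard (iteratedJoin T 𝒰 n) ≤ t.card := by
    let W : X → Set X := fun y => ⋂ k : Fin n, T^[k] ⁻¹' (c (T^[k] y)).1
    have hmem : minSubcoverCard (iteratedJoin T 𝒰 n) ≤ (W '' (t : Set X)).ncard :=
      Nat.sInf_le ⟨W '' t, ?_, t.finite_toSet.image W, ?_, rfl⟩
    · exact hmem.trans ((ncard_image_le t.finite_toSet).trans (ncard_coe_finset t).le)
    · rintro _ ⟨y, -, rfl⟩
      exact ⟨fun k => (c (T^[k] y)).1, fun k => (c _).2, rfl⟩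
    · refine eq_univ_of_forall fun x => ?_
      obtain ⟨y, hy, hxy⟩ := mem_iUnion₂.1 (ht (mem_univ x))
      exact ⟨W y, mem_image_of_mem W hy, mem_iInter.2 fun k => hc _ (hxy k)⟩
  have hlim : Tendsto (fun n : ℕ => ((Real.log t.card / n : ℝ) : EReal)) atTop (nhds 0) :=
    EReal.tendsto_coe.2 (tendsto_const_div_atTop_nhds_zero_nat _)
  refine (limsup_le_limsup (Eventually.of_forall fun n => ?_)).trans_eq hlim.limsup_eq
  refine EReal.coe_le_coe_iff.2 (div_le_div_of_nonneg_right ?_ n.cast_nonneg)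
  rcases (minSubcoverCard (iteratedJoin T 𝒰 n)).eq_zero_or_pos with h | h
  · rw [h, Nat.cast_zero, Real.log_zero]
    exact Real.log_natCast_nonneg _
  · exact Real.log_le_log (Nat.cast_pos.2 h) (Nat.cast_le.2 (hcard n))

/-- If an observable `f` can realize every sequence of values in an infinite set `E` along the
forward orbits of `T`, then `T` has infinite entropy: it factors onto shifts over arbitrarily many
symbols. -/
theorem topEntropy_eq_top_of_realizes_sequences [TopologicalSpace X] {Y : Type*}
    [TopologicalSpace Y] [T1Space Y] {T : X → X} {f : X → Y} (hf : Continuous f) {E : Set Y}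
    (hE : E.Infinite)
    (h : ∀ s : ℕ → Y, (∀ k, s k ∈ E) → ∃ x, ∀ k, f (T^[k] x) = s k) : topEntropy T = ⊤ := by
  refine EReal.eq_top_iff_forall_lt _ |>.2 fun r => ?_
  obtain ⟨m, hm⟩ := exists_nat_gt (Real.exp r)
  have hm0 : 0 < m := Nat.cast_pos.1 ((Real.exp_pos r).trans hm)
  have hrm : r < Real.log m := (Real.lt_log_iff_exp_lt (Nat.cast_pos.2 hm0)).2 hm
  refine (EReal.coe_lt_coe_iff.2 hrm).trans_le ?_
  obtain ⟨w, hwE, hw⟩ : ∃ w : Fin m → Y, (∀ i, w i ∈ E) ∧ Injective w :=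
    ⟨fun i => (hE.natEmbedding E i : Y), fun i => (hE.natEmbedding E i).2, fun i j hij =>
      Fin.ext ((hE.natEmbedding E).injective (Subtype.ext hij))⟩
  -- `U i` is the only member of the cover that contains the points where `f` takes the value `w i`.
  let U : Fin m → Set X := fun i => f ⁻¹' (w '' {i}ᶜ)ᶜ
  have hU {i j : Fin m} {x : X} (hx : f x = w i) : x ∈ U j ↔ i = j := by
    simp [U, hx, hw.eq_iff]
  have hcover : ⋃₀ range U = univ := by
    refine eq_univ_of_forall fun x => ?_
    rw [sUnion_range, mem_iUnion]
    by_cases hx : ∃ i, f x = w i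
    · obtain ⟨i, hi⟩ := hx
      exact ⟨i, (hU hi).2 rfl⟩
    · exact ⟨⟨0, hm0⟩, fun ⟨i, _, hi⟩ => hx ⟨i, hi.symm⟩⟩
  have hcard (n : ℕ) : m ^ n ≤ minSubcoverCard (iteratedJoin T (range U) n) := by
    refine le_csInf ?_ ?_
    · refine ⟨_, iteratedJoin T (range U) n, subset_rfl, ?_, ?_, rfl⟩
      · refine (Set.finite_range fun s : Fin n → Fin m => ⋂ k : Fin n, T^[k] ⁻¹' U (s k)).subset ?_
        rintro _ ⟨s, hs, rfl⟩
        choose i hi using hs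
        exact ⟨i, by simp only [hi]⟩
      · refine eq_univ_of_forall fun x => ?_
        choose V hV hxV using fun y : X => mem_sUnion.1 (hcover.ge (mem_univ y))
        exact ⟨_, ⟨fun k => V (T^[k] x), fun k => hV _, rfl⟩, mem_iInter.2 fun k => hxV _⟩
    · rintro _ ⟨𝒲, hsub, hfin, hcov, rfl⟩
      have hx (s : Fin n → Fin m) : ∃ x, ∀ k : Fin n, f (T^[k] x) = w (s k) := by
        obtain ⟨x, hx⟩ := h (fun k => if hk : k < n then w (s ⟨k, hk⟩) else w ⟨0, hm0⟩)
          fun k => by split_ifs <;> exact hwE _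
        exact ⟨x, fun k => by simp [hx]⟩
      choose x hx using hx
      choose V hV hxV using fun s => mem_sUnion.1 (hcov.ge (mem_univ (x s)))
      have hinj : Injective V := fun s s' hss => by
        obtain ⟨v, hv, hVv⟩ := hsub (hV s)
        choose i hi using hv
        funext k
        have h₁ := hxV s
        have h₂ := hxV s'
        rw [← hss] at h₂
        rw [hVv, mem_iInter] at h₁ h₂
        have h₁ := h₁ k
        have h₂ := h₂ k
        rw [← hi, mem_preimage] at h₁ h₂
        exact ((hU (hx s k)).1 h₁).trans ((hU (hx s' k)).1 h₂).symm
      calc m ^ n = (range V).ncard := by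
            rw [← image_univ, ncard_image_of_injective _ hinj, ncard_univ, Nat.card_fun,
              Nat.card_fin, Nat.card_fin]
        _ ≤ 𝒲.ncard := ncard_le_ncard (range_subset_iff.2 hV) hfin
  have hentropy : (Real.log m : EReal) ≤ coverEntropyOf T (range U) := by
    refine le_limsup_of_frequently_le ((eventually_gt_atTop 0).frequently.mono fun n hn => ?_)
    refine EReal.coe_le_coe_iff.2 ((le_div_iff₀ (Nat.cast_pos.2 hn)).2 ?_)
    rw [mul_comm, ← Real.log_pow, ← Nat.cast_pow]
    exact Real.log_le_log (Nat.cast_pos.2 (pow_pos hm0 n)) (Nat.cast_le.2 (hcard n))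
  refine hentropy.trans (le_iSup₂ (f := fun 𝒰 _ => coverEntropyOf T 𝒰) (range U)
    ⟨finite_range U, ?_, hcover⟩)
  rintro _ ⟨i, rfl⟩
  exact ((toFinite _).isClosed.isOpen_compl).preimage hf

end EntropyCriteria

/-! ### Compactness of the state space -/

section CompactStateSpace

open scoped ComplexOrder InnerProductSpace

variable {A : Type*} [CStarAlgebra A]

instance : T2Space (StateSpace A) :=
  inferInstanceAs (T2Space {φ : WeakDual ℂ A // (∀ a : A, 0 ≤ φ (star a * a)) ∧ φ 1 = 1})

/-- States are contractive, by the Cauchy–Schwarz inequality for the GNS inner product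
`⟪a, b⟫ = φ (star a * b)` and the estimate `star a * a ≤ ‖a‖ ^ 2`. -/
theorem StateSpace.norm_apply_le (φ : StateSpace A) (a : A) : ‖φ.1 a‖ ≤ ‖a‖ := by
  let _ : PartialOrder A := CStarAlgebra.spectralOrder A
  have _ : StarOrderedRing A := CStarAlgebra.spectralOrderedRing A
  let f : A →ₚ[ℂ] ℂ := PositiveLinearMap.mk₀ (φ.1 : A →ₗ[ℂ] ℂ) fun x hx => by
    obtain ⟨b, rfl⟩ := CStarAlgebra.nonneg_iff_eq_star_mul_self.1 hx
    exact φ.2.1 b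
  have hf (x : A) : f x = φ.1 x := rfl
  have hnorm (x : A) : ‖f.toPreGNS x‖ ≤ ‖x‖ := by
    refine le_of_sq_le_sq ?_ (norm_nonneg x)
    have h := OrderHomClass.mono f (CStarAlgebra.star_mul_le_algebraMap_norm_sq (a := x))
    have h' : f (algebraMap ℝ A (‖x‖ ^ 2)) = ((‖x‖ ^ 2 : ℝ) : ℂ) := by
      rw [Algebra.algebraMap_eq_smul_one, ← Complex.coe_smul, map_smul, hf, φ.2.2, smul_eq_mul,
        mul_one]
    rw [h'] at h
    have hsq := f.preGNS_norm_sq (f.toPreGNS x)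
    rw [PositiveLinearMap.ofPreGNS_toPreGNS] at hsq
    rw [← hsq] at h
    exact_mod_cast h
  have hinner := norm_inner_le_norm (𝕜 := ℂ) (f.toPreGNS 1) (f.toPreGNS a)
  rw [PositiveLinearMap.preGNS_inner_def] at hinner
  simp only [PositiveLinearMap.ofPreGNS_toPreGNS, star_one, one_mul, hf] at hinner
  refine hinner.trans ((mul_le_mul (hnorm 1) (hnorm a) (norm_nonneg _) (norm_nonneg _)).trans ?_)
  rcases subsingleton_or_nontrivial A with _ | _
  · simp [Subsingleton.elim a 0]
  · simp

instance : CompactSpace (StateSpace A) := by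
  refine isCompact_iff_compactSpace (s := {φ : WeakDual ℂ A |
    (∀ a : A, 0 ≤ φ (star a * a)) ∧ φ 1 = 1}).1 ?_
  refine (WeakDual.isCompact_closedBall (𝕜 := ℂ) (0 : StrongDual ℂ A) 1).of_isClosed_subset ?_ ?_
  · rw [Set.ofPred_and, Set.ofPred_forall]
    exact (isClosed_iInter fun a => isClosed_le continuous_const (WeakDual.eval_continuous _)).inter
      (isClosed_eq (WeakDual.eval_continuous _) continuous_const)
  · intro φ hφ
    rw [Set.mem_preimage, mem_closedBall_zero_iff]
    exact ContinuousLinearMap.opNorm_le_bound _ zero_le_one fun a => by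
      rw [one_mul]
      exact StateSpace.norm_apply_le ⟨φ, hφ⟩ a

end CompactStateSpace

/-! ### States of a full group C⋆-algebra -/

section GroupStates

open scoped ComplexOrder InnerProductSpace
open UniformSpace FullGroupCStar

universe v

variable {G : Type v} [Group G]

namespace FullGroupCStar

/-- The canonical map `ℂ[G] → C⋆(G)` as a continuous linear map. -/
noncomputable def ofAlgCLM : GroupAlg G →L[ℂ] FullGroupCStar G where
  toFun := ofAlg
  map_add' := ofAlg_add
  map_smul' := ofAlg_smul
  cont := continuous_ofAlg

theorem denseRange_ofAlgCLM : DenseRange (ofAlgCLM (G := G)) := Completion.denseRange_coe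

theorem isUniformInducing_ofAlgCLM : IsUniformInducing (ofAlgCLM (G := G)) :=
  Completion.isUniformInducing_coe _

theorem ofAlg_single (g : G) (c : ℂ) : ofAlg (GroupAlg.single g c) = c • u g := by
  rw [u, ← ofAlg_smul, GroupAlg.smul_single, mul_one]

theorem continuousLinearMap_ext {φ ψ : FullGroupCStar G →L[ℂ] ℂ} (h : ∀ g, φ (u g) = ψ (u g)) :
    φ = ψ := by
  ext x
  induction x using FullGroupCStar.induction with
  | hp => exact isClosed_eq φ.continuous ψ.continuous
  | ih a =>
    induction a using GroupAlg.induction with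
    | zero => exact (map_zero (φ.comp ofAlgCLM)).trans (map_zero (ψ.comp ofAlgCLM)).symm
    | add x y hx hy => rw [ofAlg_add, map_add, map_add, hx, hy]
    | sing g c => rw [ofAlg_single, map_smul, map_smul, h]

end FullGroupCStar

/-- The positive functional `a ↦ ⟪ξ, π(a) ξ⟫` on `ℂ[G]` of a vector `ξ` in a unitary
representation `π`. -/
noncomputable def GroupAlg.vectorFunctional (π : UnitaryRep G) (ξ : π.H) : GroupAlg G →L[ℂ] ℂ :=
  LinearMap.mkContinuous
    ((innerSL ℂ ξ).toLinearMap ∘ₗ (ContinuousLinearMap.apply ℂ π.H ξ).toLinearMap ∘ₗ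
      (GroupAlg.rep π).toLinearMap) (‖ξ‖ * ‖ξ‖) fun a => by
    refine (norm_inner_le_norm _ _).trans ?_
    rw [mul_assoc, mul_comm ‖ξ‖ ‖a‖]
    refine mul_le_mul_of_nonneg_left ?_ (norm_nonneg ξ)
    exact ((GroupAlg.rep π a).le_opNorm ξ).trans
      (mul_le_mul_of_nonneg_right (GroupAlg.norm_rep_le π a) (norm_nonneg ξ))

theorem GroupAlg.vectorFunctional_apply (π : UnitaryRep G) (ξ : π.H) (a : GroupAlg G) :
    GroupAlg.vectorFunctional π ξ a = ⟪ξ, GroupAlg.rep π a ξ⟫_ℂ := rfl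

/-- The extension of `a ↦ ⟪ξ, π(a) ξ⟫` to `C⋆(G)`. -/
noncomputable def FullGroupCStar.vectorFunctional (π : UnitaryRep G) (ξ : π.H) :
    FullGroupCStar G →L[ℂ] ℂ :=
  (GroupAlg.vectorFunctional π ξ).extend ofAlgCLM

theorem FullGroupCStar.vectorFunctional_ofAlg (π : UnitaryRep G) (ξ : π.H) (a : GroupAlg G) :
    vectorFunctional π ξ (ofAlg a) = ⟪ξ, GroupAlg.rep π a ξ⟫_ℂ :=
  ContinuousLinearMap.extend_eq _ denseRange_ofAlgCLM isUniformInducing_ofAlgCLM a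

theorem FullGroupCStar.vectorFunctional_u (π : UnitaryRep G) (ξ : π.H) (g : G) :
    vectorFunctional π ξ (u g) = ⟪ξ, (π.hom g : π.H →L[ℂ] π.H) ξ⟫_ℂ := by
  rw [u, vectorFunctional_ofAlg, GroupAlg.rep_single, one_smul]

/-- The vector state `a ↦ ⟪ξ, π(a) ξ⟫` of a unit vector `ξ` in a unitary representation `π`. -/
noncomputable def FullGroupCStar.vectorState (π : UnitaryRep G) (ξ : π.H) (hξ : ‖ξ‖ = 1) :
    StateSpace (FullGroupCStar G) :=
  ⟨StrongDual.toWeakDual (vectorFunctional π ξ), by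
    refine ⟨fun x => ?_, ?_⟩
    · change 0 ≤ vectorFunctional π ξ (star x * x)
      induction x using FullGroupCStar.induction with
      | hp =>
        exact isClosed_le continuous_const
          ((vectorFunctional π ξ).continuous.comp (continuous_star'.mul continuous_id))
      | ih a =>
        rw [star_ofAlg, ← ofAlg_mul, vectorFunctional_ofAlg, map_mul, GroupAlg.rep_star,
          mul_apply_eq_comp, ContinuousLinearMap.star_eq_adjoint,
          ContinuousLinearMap.adjoint_inner_right, inner_self_eq_norm_sq_to_K]
        exact pow_nonneg (Complex.zero_le_real.2 (norm_nonneg (GroupAlg.rep π a ξ))) 2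
    · change vectorFunctional π ξ (u 1) = 1
      rw [vectorFunctional_u, map_one, OneMemClass.coe_one, one_apply_eq_self,
        inner_self_eq_norm_sq_to_K, hξ]
      simp⟩

end GroupStates

/-! ### The entropy of free permutations -/

section FreePermutation

open scoped InnerProductSpace
open Function FullGroupCStar

/-- The one-dimensional unitary representation of a free group that sends the generator of index
`j` to the scalar `z j`. -/
noncomputable def freeGroupCharacter (z : ℤ → Circle) : UnitaryRep (FreeGroup ℤ) where
  H := ℂ
  hom := FreeGroup.lift fun j =>
    ⟨(z j : ℂ) • 1, by
      rw [Unitary.mem_iff]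
      simp [star_smul, smul_smul, ← Circle.coe_inv_eq_conj]⟩

/-- Each assignment of unimodular values to the canonical unitaries of `C⋆(F_ℤ)` is attained by a
state. -/
theorem exists_state_apply_u_of (z : ℤ → Circle) :
    ∃ φ : StateSpace (FullGroupCStar (FreeGroup ℤ)), ∀ j, φ.1 (u (FreeGroup.of j)) = z j := by
  refine ⟨vectorState (freeGroupCharacter z) (1 : ℂ) (norm_one (α := ℂ)), fun j => ?_⟩
  refine (vectorFunctional_u (freeGroupCharacter z) (1 : ℂ) _).trans ?_
  have h : (freeGroupCharacter z).hom (FreeGroup.of j) = _ := FreeGroup.lift_apply_of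
  rw [h]
  change ⟪(1 : ℂ), (z j : ℂ) • (1 : ℂ)⟫_ℂ = z j
  simp

theorem infinite_range_coe_circle : (Set.range fun w : Circle => (w : ℂ)).Infinite := by
  have : Infinite Circle := Set.infinite_univ_iff.1 <|
    Set.infinite_of_injOn_mapsTo (f := Circle.exp) (s := Set.Ioc (-Real.pi) Real.pi)
      (fun x hx y hy h => by
        rw [← Circle.arg_exp hx.1 hx.2, h, Circle.arg_exp hy.1 hy.2])
      (Set.mapsTo_univ _ _) (Set.Ioc_infinite (by linarith [Real.pi_pos]))
  exact Set.infinite_range_of_injective Circle.coe_injective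

theorem stateSpaceMap_freePermAut_iterate_apply_u (σ : Equiv.Perm ℤ) (k : ℕ)
    (φ : StateSpace (FullGroupCStar (FreeGroup ℤ))) (g : FreeGroup ℤ) :
    ((stateSpaceHomeomorph (freePermAut σ))^[k] φ).1 (u g) =
      φ.1 (u ((FreeGroup.freeGroupCongr σ)^[k] g)) := by
  induction k generalizing g with
  | zero => rfl
  | succ k ih =>
    rw [iterate_succ_apply', iterate_succ_apply, ← ih]
    exact congrArg _ (mapEquiv_u _ g)

theorem freeGroupCongr_iterate_of (σ : Equiv.Perm ℤ) (k : ℕ) (j : ℤ) :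
    (FreeGroup.freeGroupCongr σ)^[k] (FreeGroup.of j) = FreeGroup.of (σ^[k] j) := by
  induction k generalizing j with
  | zero => rfl
  | succ k ih => exact ih (σ j)

/-- If all points are periodic for `σ`, then so are all words, since a word involves only finitely
many generators. -/
theorem mem_periodicPts_freeGroupCongr {σ : Equiv.Perm ℤ} (hσ : ∀ j, j ∈ periodicPts σ)
    (g : FreeGroup ℤ) : g ∈ periodicPts (FreeGroup.freeGroupCongr σ) := by
  have hone (k : ℕ) : (FreeGroup.freeGroupCongr σ)^[k] 1 = 1 := iterate_fixed (map_one _) k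
  induction g using FreeGroup.induction_on with
  | C1 => exact ⟨1, one_pos, hone 1⟩
  | of j =>
    obtain ⟨p, hp, h⟩ := hσ j
    exact ⟨p, hp, by rw [IsPeriodicPt, IsFixedPt, freeGroupCongr_iterate_of, h.eq]⟩
  | inv_of j ih =>
    obtain ⟨p, hp, h⟩ := ih
    exact ⟨p, hp, by rw [IsPeriodicPt, IsFixedPt, iterate_map_inv, h.eq]⟩
  | mul x y hx hy =>
    obtain ⟨p, hp, hx⟩ := hx
    obtain ⟨q, hq, hy⟩ := hy
    exact ⟨p * q, mul_pos hp hq, by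
      rw [IsPeriodicPt, IsFixedPt, iterate_map_mul, (hx.mul_const q).eq, (hy.const_mul p).eq]⟩

theorem injective_iterate_of_notMem_periodicPts {α : Type*} {f : α → α} (hf : Injective f) {a : α}
    (ha : a ∉ periodicPts f) : Injective fun k : ℕ => f^[k] a := by
  refine Injective.of_lt_imp_ne fun m n hmn h => ha ⟨n - m, Nat.sub_pos_of_lt hmn, ?_⟩
  exact iterate_cancel hf h.symm

theorem finite_range_zpow_apply_iff_mem_periodicPts {α : Type*} {σ : Equiv.Perm α} {a : α} :
    (Set.range fun n : ℤ => (σ ^ n) a).Finite ↔ a ∈ periodicPts σ := by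
  refine ⟨fun h => ?_, fun h => ?_⟩
  · by_contra ha
    refine Set.infinite_range_of_injective
      (injective_iterate_of_notMem_periodicPts σ.injective ha) (h.subset ?_)
    rintro _ ⟨k, rfl⟩
    exact ⟨k, by simp [Equiv.Perm.iterate_eq_pow]⟩
  · have hp : 0 < (minimalPeriod σ a : ℤ) := by exact_mod_cast minimalPeriod_pos_of_mem_periodicPts h
    refine ((Set.finite_Ico 0 (minimalPeriod σ a : ℤ)).image fun n : ℤ => (σ ^ n) a).subset ?_
    rintro _ ⟨n, rfl⟩
    exact ⟨n % minimalPeriod σ a, ⟨Int.emod_nonneg _ hp.ne', Int.emod_lt_of_pos _ hp⟩,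
      MulAction.zpow_smul_mod_minimalPeriod σ a n⟩

/-- The points `σ^k(j)` with `k` natural are distinct, so that characters realize every
sequence of unimodular numbers as the values `φ(u_{σ^k(j)})`. -/
theorem topEntropy_freePermAut_eq_top {σ : Equiv.Perm ℤ} {j : ℤ}
    (hj : (Set.range fun n : ℤ => (σ ^ n) j).Infinite) :
    topEntropy (stateSpaceHomeomorph (freePermAut σ)) = ⊤ := by
  have hinj : Injective fun k : ℕ => σ^[k] j :=
    injective_iterate_of_notMem_periodicPts σ.injective fun h =>
      hj (finite_range_zpow_apply_iff_mem_periodicPts.2 h)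
  refine topEntropy_eq_top_of_realizes_sequences
    (f := fun φ : StateSpace (FullGroupCStar (FreeGroup ℤ)) => φ.1 (u (FreeGroup.of j)))
    ((WeakDual.eval_continuous _).comp continuous_subtype_val) infinite_range_coe_circle
    fun s hs => ?_
  choose z hz using hs
  obtain ⟨φ, hφ⟩ := exists_state_apply_u_of (extend (fun k : ℕ => σ^[k] j) z 1)
  refine ⟨φ, fun k => ?_⟩
  rw [stateSpaceMap_freePermAut_iterate_apply_u, freeGroupCongr_iterate_of, hφ, ← hz,
    hinj.extend_apply z 1 k]

/-- If all orbits of `σ` are finite, then each function `φ ↦ φ(u_g)` has a finite orbit under the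
induced homeomorphism.  As these functions induce the topology of the state space, the iterates of
the homeomorphism are uniformly equicontinuous. -/
theorem topEntropy_freePermAut_le_zero {σ : Equiv.Perm ℤ} (hσ : ∀ j, j ∈ periodicPts σ) :
    topEntropy (stateSpaceHomeomorph (freePermAut σ)) ≤ 0 := by
  let e : StateSpace (FullGroupCStar (FreeGroup ℤ)) → FreeGroup ℤ → ℂ := fun φ g => φ.1 (u g)
  have hcont : Continuous e := continuous_pi fun g =>
    (WeakDual.eval_continuous _).comp continuous_subtype_val
  have hinj : Injective e := fun φ ψ h => Subtype.ext <|
    continuousLinearMap_ext (φ := WeakDual.toStrongDual φ.1) (ψ := WeakDual.toStrongDual ψ.1)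
      (congrFun h)
  have he := (hcont.isClosedEmbedding hinj).isEmbedding
  let _ := he.comapUniformSpace
  have heu : IsUniformInducing e := ⟨rfl⟩
  refine topEntropy_le_zero_of_uniformEquicontinuous (heu.uniformEquicontinuous_iff.2 ?_)
  have hcoord (g : FreeGroup ℤ) : UniformEquicontinuous fun (k : ℕ) φ =>
      e ((stateSpaceHomeomorph (freePermAut σ))^[k] φ) g := by
    obtain ⟨p, hp, hgp⟩ := mem_periodicPts_freeGroupCongr hσ g
    have hfin : UniformEquicontinuous fun (i : Fin p) φ =>
        e φ ((FreeGroup.freeGroupCongr σ)^[i] g) :=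
      uniformEquicontinuous_finite.2 fun i =>
        (Pi.uniformContinuous_proj (fun _ : FreeGroup ℤ => ℂ) _).comp heu.uniformContinuous
    convert hfin.comp fun k : ℕ => (⟨k % p, Nat.mod_lt k hp⟩ : Fin p) using 1
    funext k φ
    exact (stateSpaceMap_freePermAut_iterate_apply_u σ k φ g).trans
      (congrArg (e φ) (hgp.iterate_mod_apply k).symm)
  -- The uniform structure of a product is the infimum of those induced by the coordinates.
  refine uniformEquicontinuous_iInf_rng.2 fun g U hU => ?_
  obtain ⟨V, hV, hVU⟩ := hU
  exact (hcoord g V hV).mono fun p hp k => hVU (hp k)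

end FreePermutation

/-- Let `σ` be a permutation of `ℤ` and `σ_*` the induced automorphism of `C⋆(F_ℤ)`.  The induced
homeomorphism `φ ↦ φ ∘ σ_*` of the state space has infinite topological entropy if and only if `σ`
has an infinite orbit. -/
theorem corollary2p4 (σ : Equiv.Perm ℤ) :
    topEntropy (stateSpaceHomeomorph (freePermAut σ)) = ⊤ ↔
      ∃ j : ℤ, (Set.range fun n : ℤ => (σ ^ n) j).Infinite := by
  refine ⟨fun h => ?_, fun ⟨j, hj⟩ => topEntropy_freePermAut_eq_top hj⟩
  by_contra! hfin
  have hle := topEntropy_freePermAut_le_zero fun j =>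
    finite_range_zpow_apply_iff_mem_periodicPts.1 (hfin j)
  rw [h] at hle
  exact absurd hle (by simp)
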